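/- Let $M$ be a smooth (Hausdorff, $\sigma$-compact, boundaryless) manifold of dimension $m+1$, not necessarily compact or connected, with a smooth Riemannian metric $a=\langle\cdot,\cdot\rangle$, $\alpha(y)=\sqrt{\langle y,y\rangle}$, Levi-Civita connection $\bar\nabla$, and let $\mathcal F$ be a smooth codimension-one foliation of $M$ with a smooth $a$-unit normal vector field $N$ (so $\mathcal F$ is transversally oriented). Let $\beta$ be a smooth 1-form with $\|\beta\|_\alpha<1$ at every point, where $\|\beta\|_\alpha$ is the pointwise dual norm, and let $F=\alpha+\beta$ be the corresponding Randers metric. For $y\neq0$ and tangent vectors $u,v,w$ at the same point put $$g_y(u,v)=\tfrac12\,\frac{\partial^2}{\partial s\,\partial t}F^2(y+su+tv)\Big|_{s=t=0},\qquad C_y(u,v,w)=\tfrac12\,\frac{\partial}{\partial t}\,g_{y+tw}(u,v)\Big|_{t=0}.$$ Let $n$ be the $F$-normal vector field of $\mathcal F$ with $\langle n,n\rangle=1$ on the side of $N$, that is, $g_n(n,w)=0$ for all $w\in T\mathcal F$ and $\langle n,N\rangle>0$. Let $g=g_n$ be the associated Riemannian metric, $\nabla$ its Levi-Civita connection, and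 let $C^\sharp_n$ be the $(1,1)$-tensor which is $g$-dual to the bilinear form $C_n(\cdot,\cdot,\nabla_n n)$, that is, $g(C^\sharp_n(u),v)=C_n(u,v,\nabla_n n)$. Let $\bar Z=\bar\nabla_N N$. (i) If $\bar\nabla\beta=0$, $\beta(N)$ is constant on $M$ and $\bar Z=0$ on $M$, then $C^\sharp_n=0$ on $M$. (ii) Suppose that $m>3$, that $\beta(N)$ is a nonnegative constant on $M$, that $\|\beta\|_\alpha$ is constant on $M$, and that the restriction of $\beta$ to $T\mathcal F$ does not vanish identically on $M$ (equivalently, under the previous conditions, it vanishes at no point). Then $C^\sharp_n=0$ on $M$ if and only if $\bar Z=0$ on $M$. -/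

import Mathlib

open Bundle Manifold VectorField
open scoped ContDiff

noncomputable section

namespace Randers

section Linear

/-! ### Minkowski norms on a vector space -/

variable {V : Type*} [AddCommGroup V] [Module ℝ V]

/-- The fundamental tensor of a Minkowski norm `F` on a vector space:
`g_y(u, v) = (1/2) ∂²/∂s∂t F²(y + s u + t v)` at `s = t = 0`. -/
def fundamentalTensor (F : V → ℝ) (y u v : V) : ℝ :=
  (1 / 2) * deriv (fun s : ℝ => deriv (fun t : ℝ => F (y + s • u + t • v) ^ 2) 0) 0

/-- The Cartan torsion of a Minkowski norm `F` on a vector space: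
`C_y(u, v, w) = (1/2) ∂/∂t g_{y + t w}(u, v)` at `t = 0`. -/
def cartanTorsion (F : V → ℝ) (y u v w : V) : ℝ :=
  (1 / 2) * deriv (fun t : ℝ => fundamentalTensor F (y + t • w) u v) 0

/-- The vector `w` which represents the linear form `φ` with respect to the nondegenerate bilinear
form `g`, that is, `g(w, v) = φ(v)` for all `v`. -/
def dualVector (g : V → V → ℝ) (φ : V → ℝ) : V :=
  Classical.epsilon fun w : V => ∀ v : V, g w v = φ v

end Linear

section Manifold

variable {E : Type*} [NormedAddCommGroup E] [NormedSpace ℝ E]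
  {H : Type*} [TopologicalSpace H] (I : ModelWithCorners ℝ E H)
  {M : Type*} [TopologicalSpace M] [ChartedSpace H M] [IsManifold I ∞ M]

/-! ### The Levi-Civita connection -/

/-- The right-hand side of the Koszul formula for a field `G` of bilinear forms,
`X G(Y, Z) + Y G(Z, X) - Z G(X, Y) + G([X, Y], Z) - G([Y, Z], X) + G([Z, X], Y)`. -/
def koszul (G : ∀ p : M, TangentSpace I p → TangentSpace I p → ℝ)
    (X Y Z : ∀ p : M, TangentSpace I p) (p : M) : ℝ :=
  mvfderiv I (fun q => G q (Y q) (Z q)) p (X p)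
    + mvfderiv I (fun q => G q (Z q) (X q)) p (Y p)
    - mvfderiv I (fun q => G q (X q) (Y q)) p (Z p)
    + G p (mlieBracket I X Y p) (Z p)
    - G p (mlieBracket I Y Z p) (X p)
    + G p (mlieBracket I Z X p) (Y p)

/-- `leviCivita I G X Y` is `∇_X Y`, where `∇` is the Levi-Civita connection of the metric `G`:
its value at `p` is the tangent vector `w` such that `2 G(w, Z(p))` is given by the Koszul formula
for every vector field `Z` which is differentiable at `p`. Existence and uniqueness of `w` are
proved in `existsUnique_koszul`. -/
def leviCivita (G : ∀ p : M, TangentSpace I p → TangentSpace I p → ℝ)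
    (X Y : ∀ p : M, TangentSpace I p) (p : M) : TangentSpace I p :=
  Classical.epsilon fun w : TangentSpace I p =>
    ∀ Z : ∀ q : M, TangentSpace I q, MDiffAt (T% Z) p → 2 * G p w (Z p) = koszul I G X Y Z p

theorem tensorialAt_koszul [CompleteSpace E]
    {G : ∀ p : M, TangentSpace I p → TangentSpace I p → ℝ} {p : M}
    (symm : ∀ q u v, G q u v = G q v u)
    (add : ∀ q u u' v, G q (u + u') v = G q u v + G q u' v)
    (smul : ∀ q (a : ℝ) u v, G q (a • u) v = a * G q u v)
    (diff : ∀ Y Z : ∀ q : M, TangentSpace I q, MDiffAt (T% Y) p → MDiffAt (T% Z) p →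
      MDiffAt (fun q => G q (Y q) (Z q)) p)
    {X Y : ∀ q : M, TangentSpace I q} (hX : MDiffAt (T% X) p) (hY : MDiffAt (T% Y) p) :
    TensorialAt I E (fun Z => koszul I G X Y Z p) p where
  smul := by
    intro f Z hf hZ
    have smul' : ∀ q (a : ℝ) u v, G q u (a • v) = a * G q u v := fun q a u v => by
      rw [symm, smul, symm]
    have e1 : (fun q => G q (Y q) ((f • Z) q)) = fun q => f q * G q (Y q) (Z q) := by
      ext q; exact smul' _ _ _ _
    have e2 : (fun q => G q ((f • Z) q) (X q)) = fun q => f q * G q (Z q) (X q) := by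
      ext q; exact smul _ _ _ _
    simp only [koszul, e1, e2]
    rw [mvfderiv_fun_mul hf (diff _ _ hY hZ), mvfderiv_fun_mul hf (diff _ _ hZ hX),
      mlieBracket_smul_right hf hZ, mlieBracket_smul_left hf hZ]
    simp [add, smul, smul', symm p (Y p) (Z p)]
    simp only [← neg_smul, smul]
    ring
  add := by
    intro Z Z' hZ hZ'
    have add' : ∀ q u v v', G q u (v + v') = G q u v + G q u v' := fun q u v v' => by
      rw [symm, add, symm, symm q v']
    have e1 : (fun q => G q (Y q) ((Z + Z') q))
        = fun q => G q (Y q) (Z q) + G q (Y q) (Z' q) := by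
      ext q; exact add' _ _ _ _
    have e2 : (fun q => G q ((Z + Z') q) (X q))
        = fun q => G q (Z q) (X q) + G q (Z' q) (X q) := by
      ext q; exact add _ _ _ _
    simp only [koszul, e1, e2]
    rw [mvfderiv_fun_add (diff _ _ hY hZ) (diff _ _ hY hZ'),
      mvfderiv_fun_add (diff _ _ hZ hX) (diff _ _ hZ' hX),
      mlieBracket_add_right hZ hZ', mlieBracket_add_left hZ hZ']
    simp [add, add']
    ring

/-- The Koszul formula determines `∇_X Y` for every metric. -/
theorem existsUnique_koszul [FiniteDimensional ℝ E]
    {G : ∀ p : M, TangentSpace I p → TangentSpace I p → ℝ} {p : M}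
    (symm : ∀ q u v, G q u v = G q v u)
    (add : ∀ q u u' v, G q (u + u') v = G q u v + G q u' v)
    (smul : ∀ q (a : ℝ) u v, G q (a • u) v = a * G q u v)
    (nondeg : ∀ u, (∀ v, G p u v = 0) → u = 0)
    (diff : ∀ Y Z : ∀ q : M, TangentSpace I q, MDiffAt (T% Y) p → MDiffAt (T% Z) p →
      MDiffAt (fun q => G q (Y q) (Z q)) p)
    {X Y : ∀ q : M, TangentSpace I q} (hX : MDiffAt (T% X) p) (hY : MDiffAt (T% Y) p) :
    ∃! w : TangentSpace I p, ∀ Z : ∀ q : M, TangentSpace I q, MDiffAt (T% Z) p →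
      2 * G p w (Z p) = koszul I G X Y Z p := by
  have : CompleteSpace E := FiniteDimensional.complete ℝ E
  have hT := tensorialAt_koszul I symm add smul diff hX hY
  let φ : TangentSpace I p →L[ℝ] ℝ := TensorialAt.mkHom _ p hT
  have hφ : ∀ Z : ∀ q : M, TangentSpace I q, MDiffAt (T% Z) p → φ (Z p) = koszul I G X Y Z p :=
    fun Z hZ => TensorialAt.mkHom_apply hT hZ
  have add' : ∀ q u v v', G q u (v + v') = G q u v + G q u v' := fun q u v v' => by
    rw [symm, add, symm, symm q v']
  have smul' : ∀ q (a : ℝ) u v, G q u (a • v) = a * G q u v := fun q a u v => by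
    rw [symm, smul, symm]
  let B : LinearMap.BilinForm ℝ (TangentSpace I p) :=
    LinearMap.mk₂ ℝ (G p) (add p) (smul p) (add' p) (smul' p)
  have hfin : FiniteDimensional ℝ (TangentSpace I p) := inferInstanceAs (FiniteDimensional ℝ E)
  have hinj : Function.Injective B := by
    rw [← LinearMap.ker_eq_bot, LinearMap.ker_eq_bot']
    intro u hu
    exact nondeg u fun v => congrArg (fun l => l v) hu
  have hsurj : Function.Surjective B :=
    (LinearMap.injective_iff_surjective_of_finrank_eq_finrank
      (Subspace.dual_finrank_eq (K := ℝ) (V := TangentSpace I p)).symm).1 hinj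
  obtain ⟨w, hw⟩ := hsurj ((1 / 2 : ℝ) • φ.toLinearMap)
  have hw' : ∀ v, 2 * G p w v = φ v := fun v => by
    have : G p w v = (1 / 2) * φ v := congrArg (fun l => l v) hw
    rw [this]; ring
  refine ⟨w, fun Z hZ => (hw' _).trans (hφ Z hZ), fun w' h' => hinj ?_⟩
  ext v
  have h1 := h' (FiberBundle.extend E v) (FiberBundle.mdifferentiableAt_extend ..)
  rw [← hφ _ (FiberBundle.mdifferentiableAt_extend ..)] at h1
  simp only [FiberBundle.extend_apply_self] at h1
  have h2 := hw' v
  change G p w' v = G p w v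
  linarith

/-- The covariant derivative of a 1-form: `(∇_X β)(Y) = X(β(Y)) - β(∇_X Y)`, with respect to the
Levi-Civita connection of `G`. -/
def covDerivForm (G : ∀ p : M, TangentSpace I p → TangentSpace I p → ℝ)
    (β : ∀ p : M, TangentSpace I p →L[ℝ] ℝ) (X Y : ∀ p : M, TangentSpace I p) (p : M) : ℝ :=
  mvfderiv I (fun q => β q (Y q)) p (X p) - β p (leviCivita I G X Y p)

/-- `∇β = 0`, with respect to the Levi-Civita connection of `G`. -/
def IsParallelForm (G : ∀ p : M, TangentSpace I p → TangentSpace I p → ℝ)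
    (β : ∀ p : M, TangentSpace I p →L[ℝ] ℝ) : Prop :=
  ∀ (X Y : ∀ p : M, TangentSpace I p) (p : M), MDiffAt (T% X) p → MDiffAt (T% Y) p →
    covDerivForm I G β X Y p = 0

/-! ### Foliations of codimension one -/

variable (M) in
/-- A smooth foliation of codimension one, given by the hyperplane field tangent to its leaves:
locally the leaves are the level sets of a smooth real function without critical points, so that the
tangent hyperplane of the leaf is the kernel of the differential of this function. -/
structure CodimOneFoliation where
  tangent : ∀ p : M, Submodule ℝ (TangentSpace I p)
  locally_submersion : ∀ p : M, ∃ U : Set M, IsOpen U ∧ p ∈ U ∧ ∃ f : M → ℝ,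
    ContMDiffOn I 𝓘(ℝ, ℝ) ∞ f U ∧ ∀ q ∈ U, mvfderiv I f q ≠ 0 ∧
      ∀ u : TangentSpace I q, u ∈ tangent q ↔ mvfderiv I f q u = 0

/-! ### Randers spaces -/

variable [RiemannianBundle (fun p : M => TangentSpace I p)]

/-- The Riemannian metric `a = ⟨·, ·⟩` of the manifold, as a field of bilinear forms. -/
def riemannianMetric (p : M) (u v : TangentSpace I p) : ℝ := inner ℝ u v

/-- A smooth vector field `N` of `a`-unit length, `a`-orthogonal to the leaves. -/
structure IsUnitNormal (𝓕 : CodimOneFoliation I M) (N : ∀ p : M, TangentSpace I p) : Prop where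
  smooth : ContMDiff I I.tangent ∞ (T% N)
  unit : ∀ p, ‖N p‖ = 1
  orthogonal : ∀ p, ∀ u ∈ 𝓕.tangent p, inner ℝ (N p) u = 0

/-- A Randers datum: a smooth 1-form `β` whose `α`-norm (the dual norm of `α(y) = √⟨y, y⟩`) is
smaller than `1` at every point. -/
structure IsRandersForm (β : ∀ p : M, TangentSpace I p →L[ℝ] ℝ) : Prop where
  smooth : ContMDiff I (I.prod 𝓘(ℝ, E →L[ℝ] ℝ)) ∞
    (fun p => TotalSpace.mk' (E →L[ℝ] ℝ)
      (E := fun p => TangentSpace I p →L[ℝ] Bundle.Trivial M ℝ p) p (β p))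
  norm_lt_one : ∀ p, ‖β p‖ < 1

/-- The Randers norm `F(y) = √⟨y, y⟩ + β(y)` on the tangent space at `p`. -/
def randersNorm (β : ∀ p : M, TangentSpace I p →L[ℝ] ℝ) (p : M) (y : TangentSpace I p) : ℝ :=
  ‖y‖ + β p y

/-- The field of bilinear forms `g = g_n`, the fundamental tensor of the Randers norm in the
direction of the vector field `n`. -/
def normalMetric (β : ∀ p : M, TangentSpace I p →L[ℝ] ℝ) (n : ∀ p : M, TangentSpace I p)
    (p : M) (u v : TangentSpace I p) : ℝ :=
  fundamentalTensor (randersNorm I β p) (n p) u v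

/-- `n` is the `F`-normal of the foliation with `⟨n, n⟩ = 1`, on the same side of the leaves
as `N`. -/
structure IsFinslerNormal (𝓕 : CodimOneFoliation I M) (N : ∀ p : M, TangentSpace I p)
    (β : ∀ p : M, TangentSpace I p →L[ℝ] ℝ) (n : ∀ p : M, TangentSpace I p) : Prop where
  unit : ∀ p, ‖n p‖ = 1
  same_side : ∀ p, 0 < inner ℝ (n p) (N p)
  normal : ∀ p, ∀ u ∈ 𝓕.tangent p, normalMetric I β n p (n p) u = 0

/-- `Z̄ = ∇̄_N N`, the curvature vector of the `N`-curves for the metric `a`. -/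
def curvatureVector (N : ∀ p : M, TangentSpace I p) : ∀ p : M, TangentSpace I p :=
  leviCivita I (riemannianMetric I) N N

/-- The (1,1)-tensor `C_n^♯`, which is `g`-dual to the bilinear form `C_n(·, ·, ∇_n n)`; here
`g = g_n`, and `∇` is the Levi-Civita connection of `g`. -/
def cartanSharp (β : ∀ p : M, TangentSpace I p →L[ℝ] ℝ) (n : ∀ p : M, TangentSpace I p)
    (p : M) (u : TangentSpace I p) : TangentSpace I p :=
  dualVector (normalMetric I β n p) fun v =>
    cartanTorsion (randersNorm I β p) (n p) u v (leviCivita I (normalMetric I β n) n n p)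

end Manifold

end Randers

end

/-!
At a point, put `F = α + b` and let `c = dF_n(N) > 0`, so that `dF_n = c ⟨N, ·⟩`. The Cartan torsion
`C_n(u, v, w)` is, up to a factor, the symmetrization of `⟨P u, v⟩ b(P w)`, where `P` is the
orthogonal projection to `n^⊥`. Hence `C_n(·, ·, w) = 0` exactly when `P w = 0` or `b ∘ P = 0`. The
second alternative means `n = N`; the first one means that `w` is `g_n`-orthogonal to the leaf. For
`w = ∇_n n`, decomposing `n = ⟨n, N⟩ N + T` with `T` tangent to the leaves, the Koszul formula
gives, for `v` tangent to the leaf,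
`g_n(∇_n n, v) = c ⟨n, N⟩² (c ⟨Z̄, v⟩ - v(c))`.
Moreover `⟨n, N⟩² = 1 + β(N)² - ‖β‖²` and `c = ⟨n, N⟩ + β(N)`, so `c` has zero derivative as soon
as `β(N)` and `‖β‖` are constant, which is also the case of a parallel `β`. Then, unless `n = N`,
the vanishing of the torsion amounts to that of `Z̄`, a field which is tangent to the leaves.
-/

namespace Randers

open scoped RealInnerProductSpace

section MinkowskiNorm

variable {V : Type*} [NormedAddCommGroup V] [InnerProductSpace ℝ V] {b : V →L[ℝ] ℝ} {y w : V}

/-- The Minkowski norm `α + b` of Randers type on an inner product space. -/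
def randersMinkowski (b : V →L[ℝ] ℝ) (y : V) : ℝ := ‖y‖ + b y

/-- The differential at `y ≠ 0` of the Randers norm `α + b`. -/
noncomputable def randersFDeriv (b : V →L[ℝ] ℝ) (y : V) : V →L[ℝ] ℝ := ‖y‖⁻¹ • innerSL ℝ y + b

/-- The orthogonal projection to the hyperplane `y^⊥`. -/
noncomputable def perpProj (y : V) : V →L[ℝ] V := (ℝ ∙ y)ᗮ.starProjection

theorem randersFDeriv_apply (b : V →L[ℝ] ℝ) (y u : V) :
    randersFDeriv b y u = ‖y‖⁻¹ * ⟪y, u⟫ + b u := rfl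

theorem perpProj_apply (y u : V) : perpProj y u = u - (⟪y, u⟫ / ‖y‖ ^ 2) • y := by
  rw [perpProj, Submodule.starProjection_orthogonal_val, Submodule.starProjection_singleton,
    RCLike.ofReal_real_eq_id, id_eq]

theorem perpProj_self (y : V) : perpProj y y = 0 := by
  rw [perpProj, Submodule.starProjection_apply_eq_zero_iff, Submodule.orthogonal_orthogonal]
  exact Submodule.mem_span_singleton_self y

theorem inner_perpProj_self_left (y u : V) : ⟪perpProj y u, y⟫ = 0 :=
  Submodule.mem_orthogonal_singleton_iff_inner_left.1
    (Submodule.starProjection_apply_mem _ u)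

theorem inner_perpProj_comm (y u v : V) : ⟪perpProj y u, v⟫ = ⟪perpProj y v, u⟫ := by
  rw [perpProj, Submodule.inner_starProjection_left_eq_right, real_inner_comm]

theorem inner_perpProj_perpProj (y u v : V) :
    ⟪perpProj y u, perpProj y v⟫ = ⟪perpProj y u, v⟫ := by
  rw [perpProj_apply y v, inner_sub_right, inner_smul_right, inner_perpProj_self_left, mul_zero,
    sub_zero]

theorem hasFDerivAt_norm (hy : y ≠ 0) : HasFDerivAt (‖·‖) (‖y‖⁻¹ • innerSL ℝ y) y := by
  have h := (hasStrictFDerivAt_norm_sq y).hasFDerivAt.sqrt (pow_ne_zero 2 (norm_ne_zero_iff.2 hy))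
  simp only [Real.sqrt_sq (norm_nonneg _)] at h
  refine h.congr_fderiv (ContinuousLinearMap.ext fun u => ?_)
  simp only [one_div, mul_inv_rev, smul_apply, coe_innerSL_apply, nsmul_eq_mul, Nat.cast_ofNat,
    smul_eq_mul]
  field_simp

theorem hasFDerivAt_randersMinkowski (b : V →L[ℝ] ℝ) (hy : y ≠ 0) :
    HasFDerivAt (randersMinkowski b) (randersFDeriv b y) y :=
  (hasFDerivAt_norm hy).add b.hasFDerivAt

theorem hasFDerivAt_apply_div_norm (b : V →L[ℝ] ℝ) (hy : y ≠ 0) :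
    HasFDerivAt (fun x => ‖x‖⁻¹ * b x) (‖y‖⁻¹ • b ∘L perpProj y) y := by
  have hy' : ‖y‖ ≠ 0 := norm_ne_zero_iff.2 hy
  have h := ((hasDerivAt_inv hy').comp_hasFDerivAt y (hasFDerivAt_norm hy)).mul b.hasFDerivAt
  refine h.congr_fderiv (ContinuousLinearMap.ext fun u => ?_)
  simp only [Function.comp_apply, neg_smul, smul_neg, add_apply, smul_apply, smul_eq_mul, neg_apply,
    coe_innerSL_apply, ContinuousLinearMap.comp_apply, perpProj_apply, map_sub, map_smul]
  field_simp
  ring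

theorem hasFDerivAt_randersFDeriv_apply (b : V →L[ℝ] ℝ) (hy : y ≠ 0) (v : V) :
    HasFDerivAt (fun x => randersFDeriv b x v) (‖y‖⁻¹ • innerSL ℝ v ∘L perpProj y) y := by
  have h := (hasFDerivAt_apply_div_norm (innerSL ℝ v) hy).add_const (b v)
  simpa only [innerSL_apply_apply, real_inner_comm, randersFDeriv_apply] using h

theorem fundamentalTensor_eq_lineDeriv {V : Type*} [AddCommGroup V] [Module ℝ V] (F : V → ℝ)
    (y u v : V) :
    fundamentalTensor F y u v
      = 1 / 2 * lineDeriv ℝ (fun x => lineDeriv ℝ (fun z => F z ^ 2) x v) y u :=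
  rfl

theorem cartanTorsion_eq_lineDeriv {V : Type*} [AddCommGroup V] [Module ℝ V] (F : V → ℝ)
    (y u v w : V) :
    cartanTorsion F y u v w = 1 / 2 * lineDeriv ℝ (fun x => fundamentalTensor F x u v) y w :=
  rfl

theorem fundamentalTensor_randersMinkowski (b : V →L[ℝ] ℝ) (hy : y ≠ 0) (u v : V) :
    fundamentalTensor (randersMinkowski b) y u v
      = ‖y‖⁻¹ * randersMinkowski b y * ⟪perpProj y u, v⟫
        + randersFDeriv b y u * randersFDeriv b y v := by
  have first_deriv : (fun x => lineDeriv ℝ (fun z => randersMinkowski b z ^ 2) x v)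
      =ᶠ[nhds y] fun x => 2 * (randersMinkowski b x * randersFDeriv b x v) := by
    filter_upwards [isOpen_ne.mem_nhds hy] with x hx
    rw [((hasFDerivAt_randersMinkowski b hx).pow 2).hasLineDerivAt v |>.lineDeriv]
    simp only [Nat.add_one_sub_one, pow_one, nsmul_eq_mul, Nat.cast_ofNat, smul_apply, smul_eq_mul]
    ring
  have second_deriv := ((hasFDerivAt_randersMinkowski b hy).mul
    (hasFDerivAt_randersFDeriv_apply b hy v)).const_mul 2 |>.hasLineDerivAt u
  rw [fundamentalTensor_eq_lineDeriv, first_deriv.lineDeriv_eq]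
  refine (congrArg _ second_deriv.lineDeriv).trans ?_
  simp only [one_div, smul_add, add_apply, smul_apply, ContinuousLinearMap.comp_apply,
    coe_innerSL_apply, smul_eq_mul, real_inner_comm]
  ring

theorem cartanTorsion_randersMinkowski (b : V →L[ℝ] ℝ) (hy : y ≠ 0) (u v w : V) :
    cartanTorsion (randersMinkowski b) y u v w
      = (2 * ‖y‖)⁻¹ * (⟪perpProj y u, v⟫ * b (perpProj y w)
        + ⟪perpProj y v, w⟫ * b (perpProj y u) + ⟪perpProj y w, u⟫ * b (perpProj y v)) := by
  have hy' : ‖y‖ ≠ 0 := norm_ne_zero_iff.2 hy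
  have tensor_eq : (fun x => fundamentalTensor (randersMinkowski b) x u v) =ᶠ[nhds y]
      fun x => (1 + ‖x‖⁻¹ * b x) * (⟪u, v⟫ - (‖x‖⁻¹ * ⟪u, x⟫) * (‖x‖⁻¹ * ⟪v, x⟫))
        + randersFDeriv b x u * randersFDeriv b x v := by
    filter_upwards [isOpen_ne.mem_nhds hy] with x hx
    rw [fundamentalTensor_randersMinkowski b hx, perpProj_apply, inner_sub_left, inner_smul_left,
      randersMinkowski, real_inner_comm x u, real_inner_comm x v]
    have hx' : ‖x‖ ≠ 0 := norm_ne_zero_iff.2 hx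
    simp only [map_div₀, Real.ringHom_apply, add_left_inj]
    field_simp
  have h := ((((hasFDerivAt_apply_div_norm b hy).const_add 1).mul
    (((hasFDerivAt_apply_div_norm (innerSL ℝ u) hy).mul
      (hasFDerivAt_apply_div_norm (innerSL ℝ v) hy)).const_sub ⟪u, v⟫)).add
    ((hasFDerivAt_randersFDeriv_apply b hy u).mul
      (hasFDerivAt_randersFDeriv_apply b hy v))).hasLineDerivAt w
  rw [cartanTorsion_eq_lineDeriv, tensor_eq.lineDeriv_eq]
  refine (congrArg _ h.lineDeriv).trans ?_
  simp only [one_div, coe_innerSL_apply, real_inner_comm, neg_add_rev, smul_add, smul_neg,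
    Pi.mul_apply, randersFDeriv_apply, add_apply, neg_apply, smul_apply,
    ContinuousLinearMap.comp_apply, perpProj_apply, smul_eq_mul, map_sub, map_smul, mul_inv_rev,
    inner_sub_left, inner_smul_left, map_div₀, Real.ringHom_apply]
  field_simp
  ring

theorem cartanTorsion_randersMinkowski_eq_zero_iff (hy : y ≠ 0) :
    (∀ u v, cartanTorsion (randersMinkowski b) y u v w = 0)
      ↔ perpProj y w = 0 ∨ ∀ v, b (perpProj y v) = 0 := by
  have hy' : (2 * ‖y‖)⁻¹ ≠ 0 := inv_ne_zero (mul_ne_zero two_ne_zero (norm_ne_zero_iff.2 hy))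
  simp only [cartanTorsion_randersMinkowski b hy, mul_eq_zero_iff_left hy']
  constructor
  · intro h
    refine or_iff_not_imp_left.2 fun hw v => ?_
    have norm_ne_zero : ⟪perpProj y w, w⟫ ≠ 0 := by
      rwa [← inner_perpProj_perpProj, Ne, inner_self_eq_zero]
    have b_perp_w : b (perpProj y w) = 0 := by
      have := h w w
      exact (mul_eq_zero_iff_left norm_ne_zero).1 (by linarith)
    have := h w v
    rw [b_perp_w] at this
    exact (mul_eq_zero_iff_left norm_ne_zero).1 (by linarith)
  · rintro (hw | hb) u v
    · rw [inner_perpProj_comm y v, hw, map_zero, inner_zero_left, inner_zero_left]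
      ring
    · rw [hb, hb, hb]
      ring

theorem randersMinkowski_pos (hb : ‖b‖ < 1) (hy : y ≠ 0) : 0 < randersMinkowski b y := by
  have hy' : 0 < ‖y‖ := norm_pos_iff.2 hy
  have : ‖b y‖ < ‖y‖ := (b.le_opNorm y).trans_lt (mul_lt_of_lt_one_left hy' hb)
  rw [randersMinkowski]
  linarith [neg_abs_le (b y), Real.norm_eq_abs (b y)]

theorem randersFDeriv_self (b : V →L[ℝ] ℝ) (y : V) :
    randersFDeriv b y y = randersMinkowski b y := by
  rcases eq_or_ne y 0 with rfl | hy
  · simp [randersFDeriv, randersMinkowski]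
  · rw [randersFDeriv_apply, randersMinkowski, real_inner_self_eq_norm_sq, pow_two,
      inv_mul_cancel_left₀ (norm_ne_zero_iff.2 hy)]

theorem fundamentalTensor_randersMinkowski_self_left (b : V →L[ℝ] ℝ) (hy : y ≠ 0) (v : V) :
    fundamentalTensor (randersMinkowski b) y y v
      = randersMinkowski b y * randersFDeriv b y v := by
  rw [fundamentalTensor_randersMinkowski b hy, perpProj_self, inner_zero_left, mul_zero, zero_add,
    randersFDeriv_self]

theorem fundamentalTensor_randersMinkowski_self_pos (hb : ‖b‖ < 1) (hy : y ≠ 0) {u : V}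
    (hu : u ≠ 0) : 0 < fundamentalTensor (randersMinkowski b) y u u := by
  have hF := randersMinkowski_pos hb hy
  have hy' : 0 < ‖y‖ := norm_pos_iff.2 hy
  rw [fundamentalTensor_randersMinkowski b hy, ← inner_perpProj_perpProj]
  by_cases hperp : perpProj y u = 0
  · have hu' : u = (⟪y, u⟫ / ‖y‖ ^ 2) • y := sub_eq_zero.1 ((perpProj_apply y u).symm.trans hperp)
    have coeff_ne_zero : ⟪y, u⟫ / ‖y‖ ^ 2 ≠ 0 := fun h => hu (by rw [hu', h, zero_smul])
    have deriv_ne_zero : randersFDeriv b y u ≠ 0 := by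
      rw [hu', map_smul, randersFDeriv_self]
      exact smul_ne_zero coeff_ne_zero hF.ne'
    rw [hperp, inner_zero_left, mul_zero, zero_add]
    exact mul_self_pos.2 deriv_ne_zero
  · exact add_pos_of_pos_of_nonneg (mul_pos (mul_pos (inv_pos.2 hy') hF)
      (real_inner_self_pos.2 hperp)) (mul_self_nonneg _)

/-- The fundamental tensor of a Randers norm as a bilinear form. -/
noncomputable def randersTensor (b : V →L[ℝ] ℝ) (y : V) : LinearMap.BilinForm ℝ V :=
  (‖y‖⁻¹ * randersMinkowski b y) • (innerₗ V ∘ₗ (perpProj y).toLinearMap)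
    + LinearMap.BilinForm.linMulLin (randersFDeriv b y).toLinearMap (randersFDeriv b y).toLinearMap

theorem randersTensor_apply (b : V →L[ℝ] ℝ) (hy : y ≠ 0) (u v : V) :
    randersTensor b y u v = fundamentalTensor (randersMinkowski b) y u v :=
  (fundamentalTensor_randersMinkowski b hy u v).symm

theorem randersTensor_comm (b : V →L[ℝ] ℝ) (y u v : V) :
    randersTensor b y u v = randersTensor b y v u := by
  simp only [randersTensor, LinearMap.add_apply, LinearMap.smul_apply, LinearMap.comp_apply,
    ContinuousLinearMap.coe_coe, innerₗ_apply_apply, LinearMap.BilinForm.linMulLin_apply,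
    inner_perpProj_comm y u, mul_comm (randersFDeriv b y u)]

theorem randersTensor_nondegenerate (hb : ‖b‖ < 1) (hy : y ≠ 0) :
    (randersTensor b y).Nondegenerate := by
  have separatingLeft : (randersTensor b y).SeparatingLeft := fun u hu => by
    by_contra hu'
    exact (fundamentalTensor_randersMinkowski_self_pos hb hy hu').ne'
      (randersTensor_apply b hy u u ▸ hu u)
  exact ⟨separatingLeft, fun u hu => separatingLeft u fun v => by rw [randersTensor_comm, hu]⟩

theorem isLinearMap_cartanTorsion_randersMinkowski (b : V →L[ℝ] ℝ) (hy : y ≠ 0) (u w : V) :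
    IsLinearMap ℝ fun v => cartanTorsion (randersMinkowski b) y u v w where
  map_add v v' := by
    simp only [cartanTorsion_randersMinkowski b hy, map_add, inner_add_left, inner_add_right]
    ring
  map_smul t v := by
    simp only [cartanTorsion_randersMinkowski b hy, map_smul, inner_smul_left, inner_smul_right,
      smul_eq_mul, RCLike.conj_to_real]
    ring

end MinkowskiNorm

theorem dualVector_eq_zero_iff {V : Type*} [AddCommGroup V] [Module ℝ V] [FiniteDimensional ℝ V]
    {B : LinearMap.BilinForm ℝ V} (hB : B.Nondegenerate) {φ : V → ℝ} (hφ : IsLinearMap ℝ φ) :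
    dualVector (fun u v => B u v) φ = 0 ↔ ∀ v, φ v = 0 := by
  have spec : ∀ v, B (dualVector (fun u v => B u v) φ) v = φ v :=
    Classical.epsilon_spec (p := fun w => ∀ v, B w v = φ v)
      ⟨(B.toDual hB).symm hφ.mk', LinearMap.BilinForm.apply_toDual_symm_apply hφ.mk'⟩
  refine ⟨fun h v => ?_, fun h => hB.1 _ fun v => (spec v).trans (h v)⟩
  rw [← spec v, h, map_zero, LinearMap.zero_apply]

theorem dualVector_cartanTorsion_randersMinkowski_eq_zero_iff {V : Type*} [NormedAddCommGroup V]
    [InnerProductSpace ℝ V] [FiniteDimensional ℝ V] {b : V →L[ℝ] ℝ} (hb : ‖b‖ < 1) {y : V}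
    (hy : y ≠ 0) {w : V} :
    (∀ u, dualVector (fundamentalTensor (randersMinkowski b) y)
        (fun v => cartanTorsion (randersMinkowski b) y u v w) = 0)
      ↔ perpProj y w = 0 ∨ ∀ v, b (perpProj y v) = 0 := by
  have tensor_eq : fundamentalTensor (randersMinkowski b) y = fun u v => randersTensor b y u v :=
    funext₂ fun u v => (randersTensor_apply b hy u v).symm
  simp only [tensor_eq, ← cartanTorsion_randersMinkowski_eq_zero_iff hy,
    dualVector_eq_zero_iff (randersTensor_nondegenerate hb hy)
      (isLinearMap_cartanTorsion_randersMinkowski b hy _ w)]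

section HyperplaneNormal

variable {V : Type*} [NormedAddCommGroup V] [InnerProductSpace ℝ V]

theorem exists_eq_smul_of_forall_inner_eq_zero {x z : V} (h : ∀ v, ⟪x, v⟫ = 0 → ⟪z, v⟫ = 0) :
    ∃ t : ℝ, z = t • x := by
  have : z ∈ (ℝ ∙ x)ᗮᗮ := (Submodule.mem_orthogonal' _ z).2 fun v hv =>
    h v (Submodule.mem_orthogonal_singleton_iff_inner_right.1 hv)
  rw [Submodule.orthogonal_orthogonal] at this
  obtain ⟨t, ht⟩ := Submodule.mem_span_singleton.1 this
  exact ⟨t, ht.symm⟩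

/-- `y` is the `α`-unit normal, for the Randers norm `α + b`, of the hyperplane which is
`α`-orthogonal to the `α`-unit vector `N`; it lies on the side of `N`. -/
structure IsRandersNormal (b : V →L[ℝ] ℝ) (N y : V) : Prop where
  norm_lt_one : ‖b‖ < 1
  norm_euclidean_normal : ‖N‖ = 1
  norm_eq_one : ‖y‖ = 1
  inner_pos : 0 < ⟪y, N⟫
  tensor_eq_zero : ∀ u, ⟪N, u⟫ = 0 → fundamentalTensor (randersMinkowski b) y y u = 0

namespace IsRandersNormal

variable {b : V →L[ℝ] ℝ} {N y : V} (h : IsRandersNormal b N y)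

include h

theorem ne_zero : y ≠ 0 :=
  norm_ne_zero_iff.1 (h.norm_eq_one.trans_ne one_ne_zero)

theorem randersFDeriv_eq_inner_add (u : V) : randersFDeriv b y u = ⟪y, u⟫ + b u := by
  rw [randersFDeriv_apply, h.norm_eq_one, inv_one, one_mul]

theorem randersFDeriv_eq_zero {u : V} (hu : ⟪N, u⟫ = 0) : randersFDeriv b y u = 0 := by
  have := h.tensor_eq_zero u hu
  rw [fundamentalTensor_randersMinkowski_self_left b h.ne_zero] at this
  exact (mul_eq_zero_iff_left (randersMinkowski_pos h.norm_lt_one h.ne_zero).ne').1 this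

theorem randersFDeriv_eq (u : V) : randersFDeriv b y u = randersFDeriv b y N * ⟪N, u⟫ := by
  have := h.randersFDeriv_eq_zero (u := perpProj N u)
    (by rw [real_inner_comm, inner_perpProj_self_left])
  rw [perpProj_apply, h.norm_euclidean_normal, one_pow, div_one, map_sub, map_smul,
    smul_eq_mul] at this
  linarith

theorem randersMinkowski_eq : randersMinkowski b y = randersFDeriv b y N * ⟪y, N⟫ := by
  rw [← randersFDeriv_self, h.randersFDeriv_eq y, real_inner_comm]

theorem randersFDeriv_pos : 0 < randersFDeriv b y N :=
  pos_of_mul_pos_left (h.randersMinkowski_eq ▸ randersMinkowski_pos h.norm_lt_one h.ne_zero)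
    h.inner_pos.le

theorem tensor_self_left (u : V) : fundamentalTensor (randersMinkowski b) y y u
    = randersFDeriv b y N ^ 2 * ⟪y, N⟫ * ⟪N, u⟫ := by
  rw [fundamentalTensor_randersMinkowski_self_left b h.ne_zero, h.randersMinkowski_eq,
    h.randersFDeriv_eq u]
  ring

theorem apply_eq_inner (u : V) : b u = ⟪randersFDeriv b y N • N - y, u⟫ := by
  have := h.randersFDeriv_eq u
  rw [h.randersFDeriv_eq_inner_add u] at this
  rw [inner_sub_left, real_inner_smul_left]
  linarith

theorem inner_sq : ⟪y, N⟫ ^ 2 = 1 + b N ^ 2 - ‖b‖ ^ 2 := by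
  have b_eq : b = innerSL ℝ (randersFDeriv b y N • N - y) :=
    ContinuousLinearMap.ext h.apply_eq_inner
  have inner_eq : ⟪y, N⟫ = randersFDeriv b y N - b N := by
    rw [h.randersFDeriv_eq_inner_add, add_sub_cancel_right]
  have norm_sq : ‖b‖ ^ 2 = randersFDeriv b y N ^ 2 - 2 * (randersFDeriv b y N * ⟪y, N⟫) + 1 := by
    conv_lhs => rw [b_eq, innerSL_apply_norm, norm_sub_sq_real, norm_smul,
      h.norm_euclidean_normal, h.norm_eq_one, real_inner_smul_left, real_inner_comm]
    rw [Real.norm_eq_abs, mul_one, sq_abs, one_pow]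
  rw [norm_sq, inner_eq]
  ring

theorem inner_eq_sqrt : ⟪y, N⟫ = √(1 + b N ^ 2 - ‖b‖ ^ 2) := by
  rw [← h.inner_sq, Real.sqrt_sq h.inner_pos.le]

theorem perpProj_eq_zero_iff {w : V} : perpProj y w = 0
    ↔ ∀ v, ⟪N, v⟫ = 0 → fundamentalTensor (randersMinkowski b) y w v = 0 := by
  have tensor_eq : ∀ v, ⟪N, v⟫ = 0 → fundamentalTensor (randersMinkowski b) y w v
      = randersMinkowski b y * ⟪perpProj y w, v⟫ := fun v hv => by
    rw [fundamentalTensor_randersMinkowski b h.ne_zero, h.randersFDeriv_eq_zero hv,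
      h.norm_eq_one, inv_one, one_mul, mul_zero, add_zero]
  have hF := (randersMinkowski_pos h.norm_lt_one h.ne_zero).ne'
  refine ⟨fun hw v hv => by rw [tensor_eq v hv, hw, inner_zero_left, mul_zero], fun hw => ?_⟩
  obtain ⟨t, ht⟩ := exists_eq_smul_of_forall_inner_eq_zero fun v hv =>
    (mul_eq_zero_iff_left hF).1 ((tensor_eq v hv).symm.trans (hw v hv))
  have inner_zero : t * ⟪y, N⟫ = 0 := by
    rw [real_inner_comm, ← real_inner_smul_left, ← ht, inner_perpProj_self_left]
  rw [ht, (mul_eq_zero_iff_right h.inner_pos.ne').1 inner_zero, zero_smul]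

theorem eq_of_forall_inner_eq_zero (hy : ∀ v, ⟪N, v⟫ = 0 → ⟪y, v⟫ = 0) : y = N := by
  obtain ⟨t, ht⟩ := exists_eq_smul_of_forall_inner_eq_zero hy
  have t_pos : 0 < t := by
    have := h.inner_pos
    rwa [ht, real_inner_smul_left, real_inner_self_eq_norm_sq, h.norm_euclidean_normal, one_pow,
      mul_one] at this
  have norm_t : |t| = 1 := by
    rw [← h.norm_eq_one, ht, norm_smul, h.norm_euclidean_normal, mul_one, Real.norm_eq_abs]
  rw [ht, ← abs_of_pos t_pos, norm_t, one_smul]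

theorem forall_apply_eq_zero_iff : (∀ v, ⟪N, v⟫ = 0 → b v = 0) ↔ y = N := by
  have apply_eq : ∀ v, ⟪N, v⟫ = 0 → b v = -⟪y, v⟫ := fun v hv => by
    linarith [h.randersFDeriv_eq_zero hv, h.randersFDeriv_eq_inner_add v]
  refine ⟨fun hb => h.eq_of_forall_inner_eq_zero fun v hv => ?_, fun hy v hv => ?_⟩
  · rw [← neg_eq_zero, ← apply_eq v hv, hb v hv]
  · rw [apply_eq v hv, hy, hv, neg_zero]

theorem forall_apply_perpProj_eq_zero_iff : (∀ v, b (perpProj y v) = 0) ↔ y = N := by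
  refine ⟨fun hb => h.eq_of_forall_inner_eq_zero fun v hv => ?_, fun hy v => ?_⟩
  · have b_proj := hb v
    rw [perpProj_apply, h.norm_eq_one, one_pow, div_one, map_sub, map_smul, smul_eq_mul] at b_proj
    have F_mul : randersMinkowski b y * ⟪y, v⟫ = 0 := by
      rw [randersMinkowski, h.norm_eq_one]
      linarith [h.randersFDeriv_eq_zero hv, h.randersFDeriv_eq_inner_add v]
    exact (mul_eq_zero_iff_left (randersMinkowski_pos h.norm_lt_one h.ne_zero).ne').1 F_mul
  · exact h.forall_apply_eq_zero_iff.2 hy _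
      (by rw [← hy, real_inner_comm, inner_perpProj_self_left])

end IsRandersNormal

end HyperplaneNormal

section Bracket

variable {E : Type*} [NormedAddCommGroup E] [NormedSpace ℝ E]

theorem fderiv_lieBracket {f : E → ℝ} {x : E} (hf : ContDiffAt ℝ 2 f x) {V W : E → E}
    (hV : DifferentiableAt ℝ V x) (hW : DifferentiableAt ℝ W x) :
    fderiv ℝ f x (lieBracket ℝ V W x)
      = fderiv ℝ (fun z => fderiv ℝ f z (W z)) x (V x)
        - fderiv ℝ (fun z => fderiv ℝ f z (V z)) x (W x) := by
  have hdf : DifferentiableAt ℝ (fderiv ℝ f) x :=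
    (hf.fderiv_right (m := 1) (by norm_num)).differentiableAt one_ne_zero
  have second_deriv_symm := hf.isSymmSndFDerivAt (by simp) (V x) (W x)
  rw [fderiv_clm_apply hdf hV, fderiv_clm_apply hdf hW, lieBracket_eq]
  simp [second_deriv_symm]

variable {H : Type*} [TopologicalSpace H] {I : ModelWithCorners ℝ E H} [I.Boundaryless]
  {M : Type*} [TopologicalSpace M] [ChartedSpace H M] [IsManifold I ∞ M] {p : M}

theorem mvfderiv_eq_fderiv_apply (f : E → ℝ) (x v : E) :
    mvfderiv 𝓘(ℝ, E) f x v = fderiv ℝ f x v := by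
  simp only [mvfderiv, mfderiv_eq_fderiv]
  rfl

theorem contMDiffAt_extChartAt_symm {x : E} (hx : x ∈ (extChartAt I p).target) :
    ContMDiffAt 𝓘(ℝ, E) I ∞ (extChartAt I p).symm x :=
  (contMDiffOn_extChartAt_symm p).contMDiffAt (extChartAt_target_mem_nhds' hx)

theorem isInvertible_mfderiv_extChartAt_symm {x : E} (hx : x ∈ (extChartAt I p).target) :
    (mfderiv 𝓘(ℝ, E) I (extChartAt I p).symm x).IsInvertible := by
  have := isInvertible_mfderivWithin_extChartAt_symm (I := I) hx
  rwa [I.range_eq_univ, mfderivWithin_univ] at this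

theorem fderiv_comp_extChartAt_symm_mpullback {x : E} (hx : x ∈ (extChartAt I p).target)
    {f : M → ℝ} (hf : MDiffAt f ((extChartAt I p).symm x)) (X : ∀ q : M, TangentSpace I q) :
    fderiv ℝ (f ∘ (extChartAt I p).symm) x (mpullback 𝓘(ℝ, E) I (extChartAt I p).symm X x)
      = mvfderiv I f ((extChartAt I p).symm x) (X ((extChartAt I p).symm x)) := by
  have chain := mvfderiv_comp_apply (I' := 𝓘(ℝ, E)) x hf
    ((contMDiffAt_extChartAt_symm hx).mdifferentiableAt (by simp))
    (mpullback 𝓘(ℝ, E) I (extChartAt I p).symm X x)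
  have mfderiv_pullback : mfderiv 𝓘(ℝ, E) I (extChartAt I p).symm x
      (mpullback 𝓘(ℝ, E) I (extChartAt I p).symm X x) = X ((extChartAt I p).symm x) :=
    (isInvertible_mfderiv_extChartAt_symm hx).self_apply_inverse _
  rw [mfderiv_pullback] at chain
  exact (mvfderiv_eq_fderiv_apply _ x _).symm.trans chain

theorem differentiableAt_mpullback_extChartAt_symm [CompleteSpace E]
    {X : ∀ q : M, TangentSpace I q} (hX : MDiffAt (T% X) p) :
    DifferentiableAt ℝ (mpullback 𝓘(ℝ, E) I (extChartAt I p).symm X : E → E)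
      (extChartAt I p p) := by
  have hx : extChartAt I p p ∈ (extChartAt I p).target := mem_extChartAt_target p
  have hX' : MDiffAt (T% X) ((extChartAt I p).symm (extChartAt I p p)) := by
    rwa [extChartAt_to_inv]
  have pullback := hX'.mpullback_vectorField (n := ∞) (contMDiffAt_extChartAt_symm hx)
    (isInvertible_mfderiv_extChartAt_symm hx) (by norm_cast)
  exact (((contMDiff_snd_tangentBundle_modelSpace E 𝓘(ℝ, E)).contMDiffAt.mdifferentiableAt
    one_ne_zero).comp _ pullback).differentiableAt

theorem mpullback_extChartAt_symm_mlieBracket [CompleteSpace E]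
    {X Y : ∀ q : M, TangentSpace I q} (hX : MDiffAt (T% X) p) (hY : MDiffAt (T% Y) p) :
    mpullback 𝓘(ℝ, E) I (extChartAt I p).symm (mlieBracket I X Y) (extChartAt I p p)
      = lieBracket ℝ (mpullback 𝓘(ℝ, E) I (extChartAt I p).symm X : E → E)
        (mpullback 𝓘(ℝ, E) I (extChartAt I p).symm Y) (extChartAt I p p) := by
  have minSmoothness_le : ∀ k : ℕ, minSmoothness ℝ k ≤ (∞ : WithTop ℕ∞) := fun k => by
    rw [minSmoothness_of_isRCLikeNormedField]
    norm_cast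
    exact le_top
  have : IsManifold I (minSmoothness ℝ 3) M := IsManifold.of_le (minSmoothness_le 3)
  rw [mpullback_mlieBracket (n := ∞) (by rwa [extChartAt_to_inv]) (by rwa [extChartAt_to_inv])
    (contMDiffAt_extChartAt_symm (mem_extChartAt_target p)) (minSmoothness_le 2),
    ← mlieBracketWithin_univ, mlieBracketWithin_eq_lieBracketWithin]
  exact congrFun (lieBracketWithin_univ (𝕜 := ℝ) (E := E)) _

theorem mvfderiv_mlieBracket [CompleteSpace E] {f : M → ℝ} (hf : ContMDiffAt I 𝓘(ℝ, ℝ) 2 f p)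
    {X Y : ∀ q : M, TangentSpace I q} (hX : MDiffAt (T% X) p) (hY : MDiffAt (T% Y) p)
    (hXf : MDiffAt (fun q => mvfderiv I f q (X q)) p)
    (hYf : MDiffAt (fun q => mvfderiv I f q (Y q)) p) :
    mvfderiv I f p (mlieBracket I X Y p)
      = mvfderiv I (fun q => mvfderiv I f q (Y q)) p (X p)
        - mvfderiv I (fun q => mvfderiv I f q (X q)) p (Y p) := by
  set φ := extChartAt I p
  have hx : φ p ∈ φ.target := mem_extChartAt_target p
  have hφp : φ.symm (φ p) = p := extChartAt_to_inv p
  have hf' : ContDiffAt ℝ 2 (f ∘ φ.symm) (φ p) :=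
    ((hφp.symm ▸ hf).comp _ ((contMDiffAt_extChartAt_symm hx).of_le (by norm_cast))).contDiffAt
  have pullback_apply : ∀ {g : M → ℝ}, MDiffAt g p → ∀ Z : ∀ q : M, TangentSpace I q,
      fderiv ℝ (g ∘ φ.symm) (φ p) (mpullback 𝓘(ℝ, E) I φ.symm Z (φ p))
        = mvfderiv I g p (Z p) := fun {g} hg Z =>
    (fderiv_comp_extChartAt_symm_mpullback hx (by rwa [hφp]) Z).trans
      (congrArg (fun q => mvfderiv I g q (Z q)) hφp)
  have deriv_eventuallyEq : ∀ Z : ∀ q : M, TangentSpace I q,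
      (fun x => fderiv ℝ (f ∘ φ.symm) x (mpullback 𝓘(ℝ, E) I φ.symm Z x)) =ᶠ[nhds (φ p)]
        (fun q => mvfderiv I f q (Z q)) ∘ φ.symm := fun Z => by
    have hf_near : ∀ᶠ q in nhds (φ.symm (φ p)), MDiffAt f q := by
      rw [hφp]
      exact ((contMDiffAt_iff_contMDiffAt_nhds (by simp)).1 hf).mono fun q hq =>
        hq.mdifferentiableAt two_ne_zero
    filter_upwards [(contMDiffAt_extChartAt_symm hx).continuousAt.eventually hf_near,
      extChartAt_target_mem_nhds p] with x hfx hx using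
      fderiv_comp_extChartAt_symm_mpullback hx hfx Z
  rw [← pullback_apply (hf.mdifferentiableAt two_ne_zero), ← pullback_apply hXf,
    ← pullback_apply hYf, ← (deriv_eventuallyEq X).fderiv_eq, ← (deriv_eventuallyEq Y).fderiv_eq,
    mpullback_extChartAt_symm_mlieBracket hX hY]
  exact fderiv_lieBracket hf' (differentiableAt_mpullback_extChartAt_symm hX)
    (differentiableAt_mpullback_extChartAt_symm hY)

end Bracket

section BundleInverse

open ContinuousLinearMap

variable {B F₁ F₂ : Type*} {n : WithTop ℕ∞} {E₁ E₂ : B → Type*}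
  [NormedAddCommGroup F₁] [NormedSpace ℝ F₁] [TopologicalSpace (TotalSpace F₁ E₁)]
  [∀ x, AddCommGroup (E₁ x)] [∀ x, Module ℝ (E₁ x)] [∀ x, TopologicalSpace (E₁ x)]
  [NormedAddCommGroup F₂] [NormedSpace ℝ F₂] [TopologicalSpace (TotalSpace F₂ E₂)]
  [∀ x, AddCommGroup (E₂ x)] [∀ x, Module ℝ (E₂ x)] [∀ x, TopologicalSpace (E₂ x)]
  {EB : Type*} [NormedAddCommGroup EB] [NormedSpace ℝ EB] {HB : Type*} [TopologicalSpace HB]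
  {IB : ModelWithCorners ℝ EB HB} [TopologicalSpace B] [ChartedSpace HB B]
  [FiberBundle F₁ E₁] [VectorBundle ℝ F₁ E₁] [FiberBundle F₂ E₂] [VectorBundle ℝ F₂ E₂]
  {ϕ : ∀ x, E₁ x →L[ℝ] E₂ x} {x : B}

theorem inCoordinates_inverse_eventuallyEq :
    (fun y => inCoordinates F₂ E₂ F₁ E₁ x y x y (ϕ y).inverse)
      =ᶠ[nhds x] fun y => (inCoordinates F₁ E₁ F₂ E₂ x y x y (ϕ y)).inverse := by
  filter_upwards [(trivializationAt F₁ E₁ x).open_baseSet.mem_nhds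
    (FiberBundle.mem_baseSet_trivializationAt' x), (trivializationAt F₂ E₂ x).open_baseSet.mem_nhds
    (FiberBundle.mem_baseSet_trivializationAt' x)] with y h₁ h₂
  rw [inCoordinates_eq h₂ h₁, inCoordinates_eq h₁ h₂]
  simp only [inverse_equiv_comp, inverse_comp_equiv, ContinuousLinearEquiv.symm_symm]
  rfl

variable [∀ x, IsTopologicalAddGroup (E₁ x)] [∀ x, ContinuousSMul ℝ (E₁ x)]
  [∀ x, IsTopologicalAddGroup (E₂ x)] [∀ x, ContinuousSMul ℝ (E₂ x)]

theorem contMDiffAt_clm_inverse [CompleteSpace F₁]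
    (hϕ : ContMDiffAt IB (IB.prod 𝓘(ℝ, F₁ →L[ℝ] F₂)) n
      (fun y => TotalSpace.mk' (F₁ →L[ℝ] F₂) (E := fun y => E₁ y →L[ℝ] E₂ y) y (ϕ y)) x)
    (hx : (ϕ x).IsInvertible) :
    ContMDiffAt IB (IB.prod 𝓘(ℝ, F₂ →L[ℝ] F₁)) n
      (fun y => TotalSpace.mk' (F₂ →L[ℝ] F₁) (E := fun y => E₂ y →L[ℝ] E₁ y) y (ϕ y).inverse)
      x := by
  obtain ⟨hid, hcoord⟩ := (contMDiffAt_hom_bundle _).1 hϕ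
  have invertible_coord : (inCoordinates F₁ E₁ F₂ E₂ x x x x (ϕ x)).IsInvertible := by
    rw [inCoordinates_eq (FiberBundle.mem_baseSet_trivializationAt' x)
      (FiberBundle.mem_baseSet_trivializationAt' x)]
    exact isInvertible_equiv.comp (hx.comp isInvertible_equiv)
  exact (contMDiffAt_hom_bundle _).2 ⟨hid,
    ((invertible_coord.contDiffAt_map_inverse.contMDiffAt).comp x hcoord).congr_of_eventuallyEq
      inCoordinates_inverse_eventuallyEq⟩

end BundleInverse

section RiemannianDual

variable {B F : Type*} {n : WithTop ℕ∞} {E : B → Type*}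
  [NormedAddCommGroup F] [NormedSpace ℝ F] [CompleteSpace F]
  [TopologicalSpace (TotalSpace F E)] [∀ x, NormedAddCommGroup (E x)]
  [∀ x, InnerProductSpace ℝ (E x)] [∀ x, CompleteSpace (E x)]
  {EB : Type*} [NormedAddCommGroup EB] [NormedSpace ℝ EB] {HB : Type*} [TopologicalSpace HB]
  {IB : ModelWithCorners ℝ EB HB} [TopologicalSpace B] [ChartedSpace HB B]
  [FiberBundle F E] [VectorBundle ℝ F E]
  [IsContMDiffRiemannianBundle IB n F E] {x : B}

theorem isInvertible_of_forall_apply_eq_inner {V : Type*} [NormedAddCommGroup V]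
    [InnerProductSpace ℝ V] [CompleteSpace V] {g : V →L[ℝ] V →L[ℝ] ℝ}
    (hg : ∀ v w, ⟪v, w⟫ = g v w) : g.IsInvertible := by
  have injective : Function.Injective g := (injective_iff_map_eq_zero g).2 fun v hv =>
    inner_self_eq_zero.1 ((hg v v).trans (congrArg (· v) hv))
  have surjective : Function.Surjective g := fun φ =>
    ⟨(InnerProductSpace.toDual ℝ V).symm φ, ContinuousLinearMap.ext fun v => by
      rw [← hg, InnerProductSpace.toDual_symm_apply]⟩
  exact ⟨ContinuousLinearEquiv.ofBijective g (LinearMap.ker_eq_bot.2 injective)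
    (LinearMap.range_eq_top.2 surjective), ContinuousLinearEquiv.coe_ofBijective ..⟩

theorem contMDiffAt_of_forall_inner_eq {β : ∀ y, E y →L[ℝ] ℝ} {b : ∀ y, E y}
    (hβ : ContMDiffAt IB (IB.prod 𝓘(ℝ, F →L[ℝ] ℝ)) n (fun y => TotalSpace.mk' (F →L[ℝ] ℝ)
      (E := fun y => E y →L[ℝ] Bundle.Trivial B ℝ y) y (β y)) x)
    (hb : ∀ y v, ⟪b y, v⟫ = β y v) : ContMDiffAt IB (IB.prod 𝓘(ℝ, F)) n (T% b) x := by
  obtain ⟨g, g_smooth, hg⟩ :=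
    IsContMDiffRiemannianBundle.exists_contMDiff (IB := IB) (n := n) (F := F) (E := E)
  have b_eq : ∀ y, b y = (g y).inverse (β y) := fun y => by
    have := ContinuousLinearMap.ext fun v => (hg y (b y) v).symm.trans (hb y v)
    rw [← this, (isInvertible_of_forall_apply_eq_inner (hg y)).inverse_apply_self]
  simp only [b_eq]
  exact (contMDiffAt_clm_inverse g_smooth.contMDiffAt
    (isInvertible_of_forall_apply_eq_inner (hg x))).clm_bundle_apply hβ

end RiemannianDual

section LeviCivita

variable {E : Type*} [NormedAddCommGroup E] [NormedSpace ℝ E]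
  {H : Type*} [TopologicalSpace H] {I : ModelWithCorners ℝ E H}
  {M : Type*} [TopologicalSpace M] [ChartedSpace H M] [IsManifold I ∞ M]

variable (I) in
/-- A field `G` of symmetric bilinear forms on the tangent spaces which is nondegenerate and
differentiable at `p`: what the Koszul formula needs in order to define `∇` at `p`. Smoothness is
encoded by the functions `G(Y, Z)`, so that `G` need not be a section of a bundle. -/
structure IsPseudoMetricAt (G : ∀ p : M, TangentSpace I p → TangentSpace I p → ℝ) (p : M) :
    Prop where
  symm : ∀ q u v, G q u v = G q v u
  add_left : ∀ q u u' v, G q (u + u') v = G q u v + G q u' v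
  smul_left : ∀ q (a : ℝ) u v, G q (a • u) v = a * G q u v
  nondegenerate : ∀ u, (∀ v, G p u v = 0) → u = 0
  mdifferentiableAt : ∀ {Y Z : ∀ q : M, TangentSpace I q}, MDiffAt (T% Y) p → MDiffAt (T% Z) p →
    MDiffAt (fun q => G q (Y q) (Z q)) p

namespace IsPseudoMetricAt

variable {G : ∀ p : M, TangentSpace I p → TangentSpace I p → ℝ} {p : M}
  {X Y Z : ∀ q : M, TangentSpace I q}

theorem zero_left (hG : IsPseudoMetricAt I G p) (v : TangentSpace I p) : G p 0 v = 0 := by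
  simpa only [zero_smul, zero_mul] using hG.smul_left p 0 0 v

theorem neg_left (hG : IsPseudoMetricAt I G p) (u v : TangentSpace I p) :
    G p (-u) v = -G p u v := by
  simpa only [neg_smul, one_smul, neg_mul, one_mul] using hG.smul_left p (-1) u v

variable [FiniteDimensional ℝ E]

theorem two_mul_leviCivita (hG : IsPseudoMetricAt I G p) (hX : MDiffAt (T% X) p)
    (hY : MDiffAt (T% Y) p) (hZ : MDiffAt (T% Z) p) :
    2 * G p (leviCivita I G X Y p) (Z p) = koszul I G X Y Z p :=
  Classical.epsilon_spec (existsUnique_koszul I hG.symm hG.add_left hG.smul_left hG.nondegenerate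
    (fun _ _ => hG.mdifferentiableAt) hX hY).exists Z hZ

theorem leviCivita_self (hG : IsPseudoMetricAt I G p) (hX : MDiffAt (T% X) p)
    (hZ : MDiffAt (T% Z) p) :
    G p (leviCivita I G X X p) (Z p) = mvfderiv I (fun q => G q (X q) (Z q)) p (X p)
      - 1 / 2 * mvfderiv I (fun q => G q (X q) (X q)) p (Z p)
      + G p (X p) (mlieBracket I Z X p) := by
  have hK := hG.two_mul_leviCivita hX hX hZ
  rw [koszul, mlieBracket_self, Pi.zero_apply, hG.zero_left, mlieBracket_swap_apply (V := X),
    hG.neg_left, hG.symm p _ (X p)] at hK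
  simp only [hG.symm _ (Z _)] at hK
  linarith

theorem two_mul_leviCivita_right (hG : IsPseudoMetricAt I G p) (hX : MDiffAt (T% X) p)
    (hY : MDiffAt (T% Y) p) : 2 * G p (leviCivita I G X Y p) (Y p)
      = mvfderiv I (fun q => G q (Y q) (Y q)) p (X p) := by
  rw [hG.two_mul_leviCivita hX hY hY, koszul, mlieBracket_self, Pi.zero_apply, hG.zero_left,
    mlieBracket_swap_apply (V := X), hG.neg_left]
  simp only [hG.symm _ (X _)]
  ring

theorem mvfderiv_self_of_isParallelForm (hG : IsPseudoMetricAt I G p)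
    {β : ∀ p : M, TangentSpace I p →L[ℝ] ℝ} (hβ : IsParallelForm I G β)
    {B : ∀ q : M, TangentSpace I q} (hB : MDiffAt (T% B) p) (hBβ : ∀ q u, G q (B q) u = β q u) :
    mvfderiv I (fun q => G q (B q) (B q)) p = 0 := by
  ext v
  have hV : MDiffAt (T% (FiberBundle.extend E v)) p := FiberBundle.mdifferentiableAt_extend ..
  have h_right := hG.two_mul_leviCivita_right hV hB
  have h_parallel := hβ _ B p hV hB
  rw [covDerivForm, ← hBβ p, hG.symm p (B p)] at h_parallel
  simp only [← hBβ] at h_parallel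
  rw [FiberBundle.extend_apply_self] at h_right h_parallel
  rw [zero_apply]
  linarith

end IsPseudoMetricAt

end LeviCivita

section Foliation

variable {E : Type*} [NormedAddCommGroup E] [NormedSpace ℝ E]
  {H : Type*} [TopologicalSpace H] {I : ModelWithCorners ℝ E H}
  {M : Type*} [TopologicalSpace M] [ChartedSpace H M]

theorem mvfderiv_congr_of_eventuallyEq {F : Type*} [NormedAddCommGroup F] [NormedSpace ℝ F]
    {f g : M → F} {p : M} (h : f =ᶠ[nhds p] g) : mvfderiv I f p = mvfderiv I g p := by
  ext v
  have mfderiv_eq : mfderiv I 𝓘(ℝ, F) f p = mfderiv I 𝓘(ℝ, F) g p :=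
    Filter.EventuallyEq.mfderiv_eq h
  exact DFunLike.congr_fun mfderiv_eq v

variable [IsManifold I ∞ M]

namespace CodimOneFoliation

theorem mlieBracket_mem_tangent [CompleteSpace E] [I.Boundaryless] (𝓕 : CodimOneFoliation I M)
    {X Y : ∀ q : M, TangentSpace I q} {p : M} (hX : MDiffAt (T% X) p) (hY : MDiffAt (T% Y) p)
    (hX_tangent : ∀ q, X q ∈ 𝓕.tangent q) (hY_tangent : ∀ q, Y q ∈ 𝓕.tangent q) :
    mlieBracket I X Y p ∈ 𝓕.tangent p := by
  obtain ⟨U, hU, hpU, f, f_smooth, hf⟩ := 𝓕.locally_submersion p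
  have deriv_eq_zero : ∀ Z : ∀ q : M, TangentSpace I q, (∀ q, Z q ∈ 𝓕.tangent q) →
      (fun q => mvfderiv I f q (Z q)) =ᶠ[nhds p] fun _ => (0 : ℝ) := fun Z hZ => by
    filter_upwards [hU.mem_nhds hpU] with q hq using ((hf q hq).2 _).1 (hZ q)
  have mdifferentiable : ∀ Z : ∀ q : M, TangentSpace I q, (∀ q, Z q ∈ 𝓕.tangent q) →
      MDiffAt (fun q => mvfderiv I f q (Z q)) p := fun Z hZ =>
    mdifferentiableAt_const.congr_of_eventuallyEq (deriv_eq_zero Z hZ)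
  have deriv2_eq_zero : ∀ Z : ∀ q : M, TangentSpace I q, (∀ q, Z q ∈ 𝓕.tangent q) →
      mvfderiv I (fun q => mvfderiv I f q (Z q)) p = 0 := fun Z hZ => by
    rw [mvfderiv_congr_of_eventuallyEq (deriv_eq_zero Z hZ), mvfderiv_const]
  rw [(hf p hpU).2, mvfderiv_mlieBracket ((f_smooth.contMDiffAt (hU.mem_nhds hpU)).of_le
    (WithTop.coe_le_coe.2 le_top)) hX hY (mdifferentiable X hX_tangent)
    (mdifferentiable Y hY_tangent), deriv2_eq_zero X hX_tangent, deriv2_eq_zero Y hY_tangent,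
    zero_apply, zero_apply, sub_zero]

end CodimOneFoliation

variable [RiemannianBundle (fun p : M => TangentSpace I p)]

namespace IsUnitNormal

variable {𝓕 : CodimOneFoliation I M} {N : ∀ p : M, TangentSpace I p} {p : M}

theorem inner_self (hN : IsUnitNormal I 𝓕 N) (p : M) : ⟪N p, N p⟫ = (1 : ℝ) := by
  rw [real_inner_self_eq_norm_sq, hN.unit, one_pow]

theorem mdifferentiableAt (hN : IsUnitNormal I 𝓕 N) (p : M) : MDiffAt (T% N) p :=
  (hN.smooth p).mdifferentiableAt (by simp)

theorem mem_tangent_iff (hN : IsUnitNormal I 𝓕 N) {u : TangentSpace I p} :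
    u ∈ 𝓕.tangent p ↔ ⟪N p, u⟫ = (0 : ℝ) := by
  refine ⟨hN.orthogonal p u, fun hu => ?_⟩
  obtain ⟨U, -, hpU, f, -, hf⟩ := 𝓕.locally_submersion p
  have mem_iff := (hf p hpU).2
  have deriv_normal_ne_zero : mvfderiv I f p (N p) ≠ 0 := fun h =>
    one_ne_zero ((hN.inner_self p).symm.trans (hN.orthogonal p _ ((mem_iff _).2 h)))
  set a := mvfderiv I f p u / mvfderiv I f p (N p)
  have sub_mem : u - a • N p ∈ 𝓕.tangent p := by
    rw [mem_iff, map_sub, map_smul, smul_eq_mul, div_mul_cancel₀ _ deriv_normal_ne_zero, sub_self]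
  have a_eq_zero : a = 0 := by
    have := hN.orthogonal p _ sub_mem
    rwa [inner_sub_right, inner_smul_right, hN.inner_self, hu, mul_one, zero_sub,
      neg_eq_zero] at this
  rwa [a_eq_zero, zero_smul, sub_zero] at sub_mem

theorem inner_mlieBracket_smul_add [CompleteSpace E] [I.Boundaryless]
    (hN : IsUnitNormal I 𝓕 N) {V T : ∀ q : M, TangentSpace I q} {f : M → ℝ} (hf : MDiffAt f p)
    (hV : MDiffAt (T% V) p) (hT : MDiffAt (T% T) p) (hV_tangent : ∀ q, V q ∈ 𝓕.tangent q)
    (hT_tangent : ∀ q, T q ∈ 𝓕.tangent q) :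
    ⟪N p, mlieBracket I V (f • N + T) p⟫
      = mvfderiv I f p (V p) + f p * ⟪N p, mlieBracket I V N p⟫ := by
  have hfN : MDiffAt (T% (f • N)) p := hf.smul_section (hN.mdifferentiableAt p)
  have bracket_tangent := 𝓕.mlieBracket_mem_tangent hV hT hV_tangent hT_tangent
  rw [mlieBracket_add_right hfN hT, mlieBracket_smul_right hf (hN.mdifferentiableAt p),
    inner_add_right, hN.orthogonal p _ bracket_tangent, inner_add_right, inner_smul_right,
    inner_smul_right, hN.inner_self, mul_one, add_zero]

variable [IsContMDiffRiemannianBundle I ∞ E (fun p : M => TangentSpace I p)]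

theorem exists_tangent_extension (hN : IsUnitNormal I 𝓕 N) {v : TangentSpace I p}
    (hv : v ∈ 𝓕.tangent p) :
    ∃ V : ∀ q : M, TangentSpace I q, MDiffAt (T% V) p ∧ V p = v ∧ ∀ q, V q ∈ 𝓕.tangent q := by
  have hE : MDiffAt (T% (FiberBundle.extend E v)) p := FiberBundle.mdifferentiableAt_extend ..
  have h_inner : MDiffAt (fun q => (⟪N q, FiberBundle.extend E v q⟫ : ℝ)) p :=
    MDifferentiableAt.inner_bundle (hN.mdifferentiableAt p) hE
  refine ⟨fun q => FiberBundle.extend E v q - (⟪N q, FiberBundle.extend E v q⟫ : ℝ) • N q,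
    mdifferentiableAt_sub_section hE (h_inner.smul_section (hN.mdifferentiableAt p)), ?_,
    fun q => hN.mem_tangent_iff.2 ?_⟩
  · beta_reduce
    rw [FiberBundle.extend_apply_self, hN.orthogonal p v hv, zero_smul, sub_zero]
  · rw [inner_sub_right, inner_smul_right, hN.inner_self, mul_one, sub_self]

end IsUnitNormal

variable [IsContMDiffRiemannianBundle I ∞ E (fun p : M => TangentSpace I p)]

theorem isPseudoMetricAt_riemannianMetric (p : M) :
    IsPseudoMetricAt I (riemannianMetric I) p where
  symm _ u v := real_inner_comm v u
  add_left _ := inner_add_left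
  smul_left _ a u v := real_inner_smul_left u v a
  nondegenerate u hu := inner_self_eq_zero.1 (hu u)
  mdifferentiableAt hY hZ := MDifferentiableAt.inner_bundle hY hZ

namespace IsUnitNormal

variable {𝓕 : CodimOneFoliation I M} {N : ∀ p : M, TangentSpace I p} {p : M}
  [FiniteDimensional ℝ E]

theorem inner_curvatureVector (hN : IsUnitNormal I 𝓕 N) {V : ∀ q : M, TangentSpace I q}
    (hV : MDiffAt (T% V) p) (hV_tangent : ∀ q, V q ∈ 𝓕.tangent q) :
    ⟪curvatureVector I N p, V p⟫ = (⟪N p, mlieBracket I V N p⟫ : ℝ) := by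
  have h := (isPseudoMetricAt_riemannianMetric p).leviCivita_self (hN.mdifferentiableAt p) hV
  simp only [riemannianMetric, hN.orthogonal _ _ (hV_tangent _), hN.inner_self, mvfderiv_const,
    zero_apply, mul_zero, sub_zero, zero_add] at h
  exact h

theorem inner_curvatureVector_self (hN : IsUnitNormal I 𝓕 N) :
    ⟪curvatureVector I N p, N p⟫ = (0 : ℝ) := by
  have h := (isPseudoMetricAt_riemannianMetric p).two_mul_leviCivita_right
    (hN.mdifferentiableAt p) (hN.mdifferentiableAt p)
  simp only [riemannianMetric, hN.inner_self, mvfderiv_const, zero_apply] at h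
  exact (mul_eq_zero_iff_left two_ne_zero).1 h

theorem curvatureVector_eq_zero_iff (hN : IsUnitNormal I 𝓕 N) :
    curvatureVector I N p = 0 ↔ ∀ v ∈ 𝓕.tangent p, ⟪curvatureVector I N p, v⟫ = (0 : ℝ) := by
  refine ⟨fun h v _ => by rw [h, inner_zero_left], fun h => ?_⟩
  obtain ⟨t, ht⟩ := exists_eq_smul_of_forall_inner_eq_zero fun v hv =>
    h v (hN.mem_tangent_iff.2 hv)
  have t_eq_zero : t = 0 := by
    have := hN.inner_curvatureVector_self (p := p)
    rwa [ht, real_inner_smul_left, hN.inner_self, mul_one] at this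
  rw [ht, t_eq_zero, zero_smul]

end IsUnitNormal

end Foliation

section RandersFoliation

variable {E : Type*} [NormedAddCommGroup E] [NormedSpace ℝ E]
  {H : Type*} [TopologicalSpace H] {I : ModelWithCorners ℝ E H}
  {M : Type*} [TopologicalSpace M] [ChartedSpace H M] [IsManifold I ∞ M]
  [RiemannianBundle (fun p : M => TangentSpace I p)]
  {𝓕 : CodimOneFoliation I M} {N n : ∀ p : M, TangentSpace I p}
  {β : ∀ p : M, TangentSpace I p →L[ℝ] ℝ} {p : M}

/-- The factor `c > 0` by which the conormals of the leaves defined by the Randers norm and by the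
Riemannian metric differ: `dF_n = c ⟨N, ·⟩`. -/
noncomputable def conormalFactor (β : ∀ p : M, TangentSpace I p →L[ℝ] ℝ)
    (N n : ∀ p : M, TangentSpace I p) (p : M) : ℝ :=
  randersFDeriv (β p) (n p) (N p)

/-- The vector field which is `a`-dual to `β`, written in terms of the two normals of the leaves;
see `IsFinslerNormal.inner_dualField`. -/
noncomputable def dualField (β : ∀ p : M, TangentSpace I p →L[ℝ] ℝ)
    (N n : ∀ p : M, TangentSpace I p) (p : M) : TangentSpace I p :=
  conormalFactor β N n p • N p - n p

namespace IsRandersForm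

theorem mdifferentiableAt_apply (hβ : IsRandersForm I β) {Y : ∀ p : M, TangentSpace I p}
    (hY : MDiffAt (T% Y) p) : MDiffAt (fun q => β q (Y q)) p := by
  have := MDifferentiableAt.clm_bundle_apply (F₁ := E) (F₂ := ℝ) (E₂ := Bundle.Trivial M ℝ)
    ((hβ.smooth p).mdifferentiableAt (by simp)) hY
  exact ((mdifferentiableAt_totalSpace ..).1 this).2

end IsRandersForm

namespace IsFinslerNormal

theorem isRandersNormal (hn : IsFinslerNormal I 𝓕 N β n) (hβ : IsRandersForm I β)
    (hN : IsUnitNormal I 𝓕 N) (p : M) : IsRandersNormal (β p) (N p) (n p) where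
  norm_lt_one := hβ.norm_lt_one p
  norm_euclidean_normal := hN.unit p
  norm_eq_one := hn.unit p
  inner_pos := hn.same_side p
  tensor_eq_zero u hu := hn.normal p u (hN.mem_tangent_iff.2 hu)

theorem inner_dualField (hn : IsFinslerNormal I 𝓕 N β n) (hβ : IsRandersForm I β)
    (hN : IsUnitNormal I 𝓕 N) (p : M) (u : TangentSpace I p) :
    ⟪dualField β N n p, u⟫ = β p u :=
  ((hn.isRandersNormal hβ hN p).apply_eq_inner u).symm

theorem inner_dualField_self (hn : IsFinslerNormal I 𝓕 N β n) (hβ : IsRandersForm I β)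
    (hN : IsUnitNormal I 𝓕 N) (p : M) :
    ⟪dualField β N n p, dualField β N n p⟫ = ‖β p‖ ^ 2 := by
  have β_eq : β p = innerSL ℝ (dualField β N n p) :=
    ContinuousLinearMap.ext fun u => (hn.inner_dualField hβ hN p u).symm
  rw [real_inner_self_eq_norm_sq, β_eq, innerSL_apply_norm]

theorem conormalFactor_eq (hn : IsFinslerNormal I 𝓕 N β n) (hβ : IsRandersForm I β)
    (hN : IsUnitNormal I 𝓕 N) (p : M) :
    conormalFactor β N n p = ⟪n p, N p⟫ + β p (N p) :=
  (hn.isRandersNormal hβ hN p).randersFDeriv_eq_inner_add _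

theorem normalMetric_apply (hn : IsFinslerNormal I 𝓕 N β n) (hβ : IsRandersForm I β)
    (hN : IsUnitNormal I 𝓕 N) (p : M) (u v : TangentSpace I p) :
    normalMetric I β n p u v
      = (1 + β p (n p)) * (⟪u, v⟫ - ⟪n p, u⟫ * ⟪n p, v⟫)
        + (⟪n p, u⟫ + β p u) * (⟪n p, v⟫ + β p v) := by
  have h := hn.isRandersNormal hβ hN p
  refine (fundamentalTensor_randersMinkowski (β p) h.ne_zero u v).trans ?_
  rw [perpProj_apply, h.randersFDeriv_eq_inner_add, h.randersFDeriv_eq_inner_add, randersMinkowski,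
    h.norm_eq_one, inner_sub_left, real_inner_smul_left]
  ring

theorem normalMetric_self_left (hn : IsFinslerNormal I 𝓕 N β n) (hβ : IsRandersForm I β)
    (hN : IsUnitNormal I 𝓕 N) (p : M) (u : TangentSpace I p) :
    normalMetric I β n p (n p) u = conormalFactor β N n p ^ 2 * ⟪n p, N p⟫ * ⟪N p, u⟫ :=
  (hn.isRandersNormal hβ hN p).tensor_self_left u

theorem ne_unitNormal (hn : IsFinslerNormal I 𝓕 N β n) (hβ : IsRandersForm I β)
    (hN : IsUnitNormal I 𝓕 N) {k r : ℝ} (hk : ∀ q, β q (N q) = k) (hr : ∀ q, ‖β q‖ = r)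
    (h : ∃ q, ∃ u ∈ 𝓕.tangent q, β q u ≠ 0) (p : M) : n p ≠ N p := by
  obtain ⟨q, u, hu, β_ne_zero⟩ := h
  intro n_eq
  have inner_eq : ⟪n q, N q⟫ = ⟪n p, N p⟫ := by
    rw [(hn.isRandersNormal hβ hN q).inner_eq_sqrt, (hn.isRandersNormal hβ hN p).inner_eq_sqrt,
      hk, hk, hr, hr]
  rw [n_eq, hN.inner_self, inner_eq_one_iff_of_norm_eq_one (hn.unit q) (hN.unit q)] at inner_eq
  exact β_ne_zero (((hn.isRandersNormal hβ hN q).forall_apply_eq_zero_iff.2 inner_eq) u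
    (hN.orthogonal q u hu))

variable [FiniteDimensional ℝ E]
  [IsContMDiffRiemannianBundle I ∞ E (fun p : M => TangentSpace I p)]

theorem mdifferentiableAt_dualField (hn : IsFinslerNormal I 𝓕 N β n) (hβ : IsRandersForm I β)
    (hN : IsUnitNormal I 𝓕 N) (p : M) : MDiffAt (T% (dualField β N n)) p := by
  have : CompleteSpace E := FiniteDimensional.complete ℝ E
  have : ∀ q : M, FiniteDimensional ℝ (TangentSpace I q) := fun _ =>
    inferInstanceAs (FiniteDimensional ℝ E)
  have : ∀ q : M, CompleteSpace (TangentSpace I q) := fun q =>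
    FiniteDimensional.complete ℝ (TangentSpace I q)
  exact (contMDiffAt_of_forall_inner_eq (hβ.smooth p)
    (hn.inner_dualField hβ hN)).mdifferentiableAt (by simp)

theorem mdifferentiableAt_inner (hn : IsFinslerNormal I 𝓕 N β n) (hβ : IsRandersForm I β)
    (hN : IsUnitNormal I 𝓕 N) (p : M) : MDiffAt (fun q => (⟪n q, N q⟫ : ℝ)) p := by
  have hB := hn.mdifferentiableAt_dualField hβ hN p
  have hBB : MDiffAt (fun q => (⟪dualField β N n q, dualField β N n q⟫ : ℝ)) p :=
    MDifferentiableAt.inner_bundle hB hB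
  have inner_eq : (fun q => (⟪n q, N q⟫ : ℝ))
      = fun q => √(1 + β q (N q) ^ 2 - ⟪dualField β N n q, dualField β N n q⟫) :=
    funext fun q => by
      rw [hn.inner_dualField_self hβ hN, (hn.isRandersNormal hβ hN q).inner_eq_sqrt]
  have ne_zero : 1 + β p (N p) ^ 2 - ⟪dualField β N n p, dualField β N n p⟫ ≠ 0 := by
    rw [hn.inner_dualField_self hβ hN, ← (hn.isRandersNormal hβ hN p).inner_sq]
    exact (pow_pos (hn.same_side p) 2).ne'
  have sqrt_differentiable : DifferentiableAt ℝ (fun x : ℝ × ℝ => √(1 + x.1 ^ 2 - x.2))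
      (β p (N p), ⟪dualField β N n p, dualField β N n p⟫) :=
    DifferentiableAt.sqrt (by fun_prop) ne_zero
  rw [inner_eq]
  exact sqrt_differentiable.comp_mdifferentiableAt (x := p)
    (f := fun q => (β q (N q), (⟪dualField β N n q, dualField β N n q⟫ : ℝ)))
    ((hβ.mdifferentiableAt_apply (hN.mdifferentiableAt p)).prodMk_space hBB)

theorem mdifferentiableAt_conormalFactor (hn : IsFinslerNormal I 𝓕 N β n)
    (hβ : IsRandersForm I β) (hN : IsUnitNormal I 𝓕 N) (p : M) :
    MDiffAt (conormalFactor β N n) p := by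
  rw [funext (hn.conormalFactor_eq hβ hN)]
  exact (hn.mdifferentiableAt_inner hβ hN p).add
    (hβ.mdifferentiableAt_apply (hN.mdifferentiableAt p))

theorem mdifferentiableAt (hn : IsFinslerNormal I 𝓕 N β n) (hβ : IsRandersForm I β)
    (hN : IsUnitNormal I 𝓕 N) (p : M) : MDiffAt (T% n) p := by
  have n_eq : n = fun q => conormalFactor β N n q • N q - dualField β N n q :=
    funext fun q => (sub_sub_cancel _ _).symm
  rw [n_eq]
  exact mdifferentiableAt_sub_section ((hn.mdifferentiableAt_conormalFactor hβ hN p).smul_section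
    (hN.mdifferentiableAt p)) (hn.mdifferentiableAt_dualField hβ hN p)

theorem isPseudoMetricAt_normalMetric (hn : IsFinslerNormal I 𝓕 N β n) (hβ : IsRandersForm I β)
    (hN : IsUnitNormal I 𝓕 N) (p : M) : IsPseudoMetricAt I (normalMetric I β n) p := by
  have ne_zero : ∀ q, n q ≠ 0 := fun q => (hn.isRandersNormal hβ hN q).ne_zero
  have metric_eq : ∀ q u v, normalMetric I β n q u v = randersTensor (β q) (n q) u v :=
    fun q u v => (randersTensor_apply (β q) (ne_zero q) u v).symm
  refine ⟨fun q u v => ?_, fun q u u' v => ?_, fun q a u v => ?_, fun u hu => ?_,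
    fun {Y Z} hY hZ => ?_⟩
  · rw [metric_eq, metric_eq, randersTensor_comm]
  · simp only [metric_eq, map_add, LinearMap.add_apply]
  · simp only [metric_eq, map_smul, LinearMap.smul_apply, smul_eq_mul]
  · exact (randersTensor_nondegenerate (hβ.norm_lt_one p) (ne_zero p)).1 u fun v => by
      rw [← metric_eq, hu]
  · have hn_diff := hn.mdifferentiableAt hβ hN p
    have mdifferentiableAt_inner : ∀ {X X' : ∀ q : M, TangentSpace I q}, MDiffAt (T% X) p →
        MDiffAt (T% X') p → MDiffAt (fun q => (⟪X q, X' q⟫ : ℝ)) p := fun hX hX' =>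
      MDifferentiableAt.inner_bundle hX hX'
    have hnY := mdifferentiableAt_inner hn_diff hY
    have hnZ := mdifferentiableAt_inner hn_diff hZ
    simp only [hn.normalMetric_apply hβ hN]
    exact ((mdifferentiableAt_const.add (hβ.mdifferentiableAt_apply hn_diff)).mul
        ((mdifferentiableAt_inner hY hZ).sub (hnY.mul hnZ))).add
      ((hnY.add (hβ.mdifferentiableAt_apply hY)).mul (hnZ.add (hβ.mdifferentiableAt_apply hZ)))

theorem inner_mlieBracket [I.Boundaryless] (hn : IsFinslerNormal I 𝓕 N β n)
    (hβ : IsRandersForm I β) (hN : IsUnitNormal I 𝓕 N) {V : ∀ q : M, TangentSpace I q}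
    (hV : MDiffAt (T% V) p) (hV_tangent : ∀ q, V q ∈ 𝓕.tangent q) :
    ⟪N p, mlieBracket I V n p⟫
      = mvfderiv I (fun q => (⟪n q, N q⟫ : ℝ)) p (V p)
        + ⟪n p, N p⟫ * ⟪curvatureVector I N p, V p⟫ := by
  have : CompleteSpace E := FiniteDimensional.complete ℝ E
  let cosAngle : M → ℝ := fun q => ⟪n q, N q⟫
  have cosAngle_diff : MDiffAt cosAngle p := hn.mdifferentiableAt_inner hβ hN p
  have tangential_diff : MDiffAt (T% (n - cosAngle • N)) p :=
    mdifferentiableAt_sub_section (hn.mdifferentiableAt hβ hN p)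
      (cosAngle_diff.smul_section (hN.mdifferentiableAt p))
  have tangential_mem : ∀ q, (n - cosAngle • N) q ∈ 𝓕.tangent q := fun q =>
    hN.mem_tangent_iff.2 <| by
      change ⟪N q, n q - (⟪n q, N q⟫ : ℝ) • N q⟫ = (0 : ℝ)
      rw [inner_sub_right, real_inner_smul_right, hN.inner_self, mul_one, real_inner_comm, sub_self]
  rw [hN.inner_curvatureVector hV hV_tangent, ← hN.inner_mlieBracket_smul_add cosAngle_diff hV
    tangential_diff hV_tangent tangential_mem, add_sub_cancel]

theorem normalMetric_self_leviCivita [I.Boundaryless] (hn : IsFinslerNormal I 𝓕 N β n)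
    (hβ : IsRandersForm I β) (hN : IsUnitNormal I 𝓕 N) {v : TangentSpace I p}
    (hv : v ∈ 𝓕.tangent p) :
    normalMetric I β n p (leviCivita I (normalMetric I β n) n n p) v
      = conormalFactor β N n p * ⟪n p, N p⟫ ^ 2
        * (conormalFactor β N n p * ⟪curvatureVector I N p, v⟫
          - mvfderiv I (conormalFactor β N n) p v) := by
  obtain ⟨V, hV, rfl, hV_tangent⟩ := hN.exists_tangent_extension hv
  have conormal_diff := hn.mdifferentiableAt_conormalFactor hβ hN p
  have cos_diff := hn.mdifferentiableAt_inner hβ hN p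
  have prod_diff : MDiffAt (fun q => conormalFactor β N n q * ⟪n q, N q⟫) p :=
    conormal_diff.mul cos_diff
  have metric_self : (fun q => normalMetric I β n q (n q) (n q))
      = fun q => (conormalFactor β N n q * ⟪n q, N q⟫) * (conormalFactor β N n q * ⟪n q, N q⟫) :=
    funext fun q => by
      rw [hn.normalMetric_self_left hβ hN, real_inner_comm]
      ring
  have koszul_eq := (hn.isPseudoMetricAt_normalMetric hβ hN p).leviCivita_self
    (hn.mdifferentiableAt hβ hN p) hV
  simp only [hn.normal _ _ (hV_tangent _), mvfderiv_const, zero_apply, zero_sub] at koszul_eq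
  rw [koszul_eq, metric_self, mvfderiv_fun_mul prod_diff prod_diff,
    mvfderiv_fun_mul conormal_diff cos_diff,
    hn.normalMetric_self_left hβ hN, hn.inner_mlieBracket hβ hN hV hV_tangent]
  simp only [add_apply, smul_apply, smul_eq_mul]
  ring

theorem cartanSharp_eq_zero_iff [I.Boundaryless] (hn : IsFinslerNormal I 𝓕 N β n)
    (hβ : IsRandersForm I β) (hN : IsUnitNormal I 𝓕 N) (p : M) :
    (∀ u, cartanSharp I β n p u = 0) ↔
      (∀ v ∈ 𝓕.tangent p, mvfderiv I (conormalFactor β N n) p v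
        = conormalFactor β N n p * ⟪curvatureVector I N p, v⟫) ∨ n p = N p := by
  have : FiniteDimensional ℝ (TangentSpace I p) := inferInstanceAs (FiniteDimensional ℝ E)
  have h := hn.isRandersNormal hβ hN p
  have prefactor_ne_zero : conormalFactor β N n p * ⟪n p, N p⟫ ^ 2 ≠ 0 :=
    (mul_pos h.randersFDeriv_pos (pow_pos h.inner_pos 2)).ne'
  refine (dualVector_cartanTorsion_randersMinkowski_eq_zero_iff h.norm_lt_one h.ne_zero).trans <|
    or_congr (h.perpProj_eq_zero_iff.trans <| forall_congr' fun v => ?_)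
      h.forall_apply_perpProj_eq_zero_iff
  rw [← hN.mem_tangent_iff]
  refine forall_congr' fun hv => ?_
  change normalMetric I β n p _ v = 0 ↔ _
  rw [hn.normalMetric_self_leviCivita hβ hN hv, mul_eq_zero_iff_left prefactor_ne_zero, sub_eq_zero,
    eq_comm]

theorem mvfderiv_conormalFactor_eq_zero (hn : IsFinslerNormal I 𝓕 N β n)
    (hβ : IsRandersForm I β) (hN : IsUnitNormal I 𝓕 N) {k : ℝ} (hk : ∀ q, β q (N q) = k)
    (h : mvfderiv I (fun q => (⟪dualField β N n q, dualField β N n q⟫ : ℝ)) p = 0) :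
    mvfderiv I (conormalFactor β N n) p = 0 := by
  have cos_diff := hn.mdifferentiableAt_inner hβ hN p
  have dual_diff := hn.mdifferentiableAt_dualField hβ hN p
  have norm_sq_diff : MDiffAt (fun q => (⟪dualField β N n q, dualField β N n q⟫ : ℝ)) p :=
    MDifferentiableAt.inner_bundle dual_diff dual_diff
  have cos_sq_diff : MDiffAt (fun q => (⟪n q, N q⟫ * ⟪n q, N q⟫ : ℝ)) p := cos_diff.mul cos_diff
  have cos_sq_add : (fun q => (⟪n q, N q⟫ * ⟪n q, N q⟫ : ℝ)
      + ⟪dualField β N n q, dualField β N n q⟫) = fun _ => 1 + k ^ 2 := funext fun q => by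
    rw [← pow_two, (hn.isRandersNormal hβ hN q).inner_sq, hn.inner_dualField_self hβ hN, hk,
      sub_add_cancel]
  have deriv_cos : mvfderiv I (fun q => (⟪n q, N q⟫ : ℝ)) p = 0 := by
    have deriv_eq := congrArg (fun f => mvfderiv I f p) cos_sq_add
    beta_reduce at deriv_eq
    rw [mvfderiv_fun_add cos_sq_diff norm_sq_diff, mvfderiv_fun_mul cos_diff cos_diff,
      h, mvfderiv_const, add_zero, ← add_smul] at deriv_eq
    exact (smul_eq_zero_iff_right (add_pos (hn.same_side p) (hn.same_side p)).ne').1 deriv_eq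
  have conormalFactor_eq_add : conormalFactor β N n = fun q => (⟪n q, N q⟫ : ℝ) + k :=
    funext fun q => by rw [hn.conormalFactor_eq hβ hN, hk]
  rw [conormalFactor_eq_add, mvfderiv_fun_add cos_diff mdifferentiableAt_const, deriv_cos,
    mvfderiv_const, add_zero]

theorem forall_cartanSharp_eq_zero_of_curvatureVector_eq_zero [I.Boundaryless]
    (hn : IsFinslerNormal I 𝓕 N β n) (hβ : IsRandersForm I β) (hN : IsUnitNormal I 𝓕 N)
    (h_conormal : mvfderiv I (conormalFactor β N n) p = 0) (hZ : curvatureVector I N p = 0)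
    (u : TangentSpace I p) : cartanSharp I β n p u = 0 :=
  (hn.cartanSharp_eq_zero_iff hβ hN p).2
    (Or.inl fun v _ => by rw [h_conormal, hZ, zero_apply, inner_zero_left, mul_zero]) u

theorem curvatureVector_eq_zero_of_forall_cartanSharp_eq_zero [I.Boundaryless]
    (hn : IsFinslerNormal I 𝓕 N β n) (hβ : IsRandersForm I β) (hN : IsUnitNormal I 𝓕 N)
    (h_conormal : mvfderiv I (conormalFactor β N n) p = 0) (h_ne : n p ≠ N p)
    (hC : ∀ u, cartanSharp I β n p u = 0) : curvatureVector I N p = 0 := by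
  have conormal_eq := ((hn.cartanSharp_eq_zero_iff hβ hN p).1 hC).resolve_right h_ne
  refine hN.curvatureVector_eq_zero_iff.2 fun v hv => ?_
  have h := conormal_eq v hv
  rw [h_conormal, zero_apply, eq_comm] at h
  exact (mul_eq_zero_iff_left (hn.isRandersNormal hβ hN p).randersFDeriv_pos.ne').1 h

end IsFinslerNormal

end RandersFoliation

end Randers

open Randers in
theorem mainTheorem10_general {E : Type*} [NormedAddCommGroup E] [NormedSpace ℝ E]
    [FiniteDimensional ℝ E] {H : Type*} [TopologicalSpace H] {I : ModelWithCorners ℝ E H}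
    [I.Boundaryless] {M : Type*} [TopologicalSpace M] [ChartedSpace H M] [IsManifold I ∞ M]
    [RiemannianBundle (fun p : M => TangentSpace I p)]
    [IsContMDiffRiemannianBundle I ∞ E (fun p : M => TangentSpace I p)]
    {𝓕 : CodimOneFoliation I M} {N n : ∀ p : M, TangentSpace I p}
    {β : ∀ p : M, TangentSpace I p →L[ℝ] ℝ} (hN : IsUnitNormal I 𝓕 N) (hβ : IsRandersForm I β)
    (hn : IsFinslerNormal I 𝓕 N β n) {k : ℝ} (hk : ∀ p, β p (N p) = k) :
    (IsParallelForm I (riemannianMetric I) β →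
      ∀ p, curvatureVector I N p = 0 → ∀ u, cartanSharp I β n p u = 0) ∧
    ((∃ r : ℝ, ∀ p, ‖β p‖ = r) → (∃ p, ∃ u ∈ 𝓕.tangent p, β p u ≠ 0) →
      ∀ p, (∀ u, cartanSharp I β n p u = 0) ↔ curvatureVector I N p = 0) := by
  refine ⟨fun h_parallel p => ?_, fun ⟨r, hr⟩ h_ne p => ?_⟩
  · have norm_sq_deriv := (isPseudoMetricAt_riemannianMetric p).mvfderiv_self_of_isParallelForm
      h_parallel (hn.mdifferentiableAt_dualField hβ hN p) (hn.inner_dualField hβ hN)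
    exact hn.forall_cartanSharp_eq_zero_of_curvatureVector_eq_zero hβ hN
      (hn.mvfderiv_conormalFactor_eq_zero hβ hN hk norm_sq_deriv)
  · have norm_sq_deriv : mvfderiv I
        (fun q => inner ℝ (dualField β N n q) (dualField β N n q)) p = 0 := by
      simp only [hn.inner_dualField_self hβ hN, hr, mvfderiv_const]
    have conormal_deriv := hn.mvfderiv_conormalFactor_eq_zero hβ hN hk norm_sq_deriv
    exact ⟨hn.curvatureVector_eq_zero_of_forall_cartanSharp_eq_zero hβ hN conormal_deriv
        (hn.ne_unitNormal hβ hN hk hr h_ne p),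
      hn.forall_cartanSharp_eq_zero_of_curvatureVector_eq_zero hβ hN conormal_deriv⟩

theorem mainTheorem10 (m : ℕ) {M : Type*} [TopologicalSpace M] [T2Space M] [SigmaCompactSpace M]
    [ChartedSpace (EuclideanSpace ℝ (Fin (m + 1))) M] [IsManifold (𝓡 (m + 1)) ∞ M]
    [RiemannianBundle (fun p : M => TangentSpace (𝓡 (m + 1)) p)]
    [IsContMDiffRiemannianBundle (𝓡 (m + 1)) ∞ (EuclideanSpace ℝ (Fin (m + 1)))
      (fun p : M => TangentSpace (𝓡 (m + 1)) p)]
    (𝓕 : Randers.CodimOneFoliation (𝓡 (m + 1)) M)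
    (N : ∀ p : M, TangentSpace (𝓡 (m + 1)) p) (hN : Randers.IsUnitNormal (𝓡 (m + 1)) 𝓕 N)
    (β : ∀ p : M, TangentSpace (𝓡 (m + 1)) p →L[ℝ] ℝ) (hβ : Randers.IsRandersForm (𝓡 (m + 1)) β)
    (n : ∀ p : M, TangentSpace (𝓡 (m + 1)) p)
    (hn : Randers.IsFinslerNormal (𝓡 (m + 1)) 𝓕 N β n) :
    (Randers.IsParallelForm (𝓡 (m + 1)) (Randers.riemannianMetric (𝓡 (m + 1))) β →
      (∃ k : ℝ, ∀ p, β p (N p) = k) →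
      (∀ p, Randers.curvatureVector (𝓡 (m + 1)) N p = 0) →
      ∀ p u, Randers.cartanSharp (𝓡 (m + 1)) β n p u = 0) ∧
    (3 < m →
      (∃ k : ℝ, 0 ≤ k ∧ ∀ p, β p (N p) = k) →
      (∃ r : ℝ, ∀ p, ‖β p‖ = r) →
      (∃ p, ∃ u ∈ 𝓕.tangent p, β p u ≠ 0) →
      ((∀ p u, Randers.cartanSharp (𝓡 (m + 1)) β n p u = 0) ↔
        ∀ p, Randers.curvatureVector (𝓡 (m + 1)) N p = 0)) := by
  refine ⟨fun h_parallel ⟨k, hk⟩ hZ p => ?_, fun _ ⟨k, _, hk⟩ h_norm h_ne => forall_congr' ?_⟩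
  · exact (mainTheorem10_general hN hβ hn hk).1 h_parallel p (hZ p)
  · exact (mainTheorem10_general hN hβ hn hk).2 h_norm h_ne
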